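/- Let $k\ge 2$. Formulas are built from propositional variables with $\neg,\wedge,\vee,\supset$. In $k$-valued Łukasiewicz logic Ł$_k$, valuations take values in $\{0,\frac1{k-1},\dots,\frac{k-2}{k-1},1\}$ and are extended by $v(\neg A)=1-v(A)$, $v(A\wedge B)=\min(v(A),v(B))$, $v(A\vee B)=\max(v(A),v(B))$, $v(A\supset B)=\min(1,1-v(A)+v(B))$; a finite set $\Gamma$ of formulas entails $B$ if $v(B)=1$ for every valuation $v$ that gives value $1$ to all members of $\Gamma$. Let $\mathcal{H}\mathsf{Łuk}_k$ be any Frege system for Ł$_k$: a finite set of axiom schemas, with modus ponens as its only rule, such that $B$ is derivable from a finite set $\Gamma$ if and only if $\Gamma$ entails $B$ in Ł$_k$. The steps of a derivation are formulas. Let Ł$_{k\vee}$ be the system whose steps are sequents $\Gamma\Rightarrow A$ with $\Gamma$ a finite set of formulas, whose axioms are $\Rightarrow A$ for each instance $A$ of an axiom schema of $\mathcal{H}\mathsf{Łuk}_k$ and $\{A\}\Rightarrow A$ for each formula $A$, and whose rules are modus ponens $$\frac{\Gamma_1\Rightarrow A\qquad \Gamma_2\Rightarrow A\supset B}{\Gamma_1\cup\Gamma_2\Rightarrow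 B}$$ and general disjunction elimination $$\frac{\Gamma_1\Rightarrow A\vee B\qquad \Gamma_2\cup\{A\}\Rightarrow C\qquad \Gamma_3\cup\{B\}\Rightarrow C}{\Gamma_1\cup(\Gamma_2\setminus\{A\})\cup(\Gamma_3\setminus\{B\})\Rightarrow C}.$$ A proof of $D$ in Ł$_{k\vee}$ is a derivation that ends with $\Rightarrow D$. Theorem. If a formula $D$ has a proof in Ł$_{k\vee}$ with $n$ steps, then $D$ has a proof in $\mathcal{H}\mathsf{Łuk}_k$ with $O(n^2\log n)$ steps, where the implied constant depends only on $k$ and the chosen system $\mathcal{H}\mathsf{Łuk}_k$. -/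

import Mathlib

namespace Lukasiewicz

/-- Propositional formulas over `¬, ∧, ∨, ⊃` with variables `p₀, p₁, …`. -/
inductive Formula : Type
  | var (i : ℕ) : Formula
  | neg (A : Formula) : Formula
  | conj (A B : Formula) : Formula
  | disj (A B : Formula) : Formula
  | imp (A B : Formula) : Formula
  deriving DecidableEq

namespace Formula

/-- Simultaneous substitution of formulas for variables. -/
def subst (σ : ℕ → Formula) : Formula → Formula
  | var i => σ i
  | neg A => neg (A.subst σ)
  | conj A B => conj (A.subst σ) (B.subst σ)
  | disj A B => disj (A.subst σ) (B.subst σ)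
  | imp A B => imp (A.subst σ) (B.subst σ)

/-- The Łukasiewicz truth functions. -/
def eval (v : ℕ → ℚ) : Formula → ℚ
  | var i => v i
  | neg A => 1 - A.eval v
  | conj A B => min (A.eval v) (B.eval v)
  | disj A B => max (A.eval v) (B.eval v)
  | imp A B => min 1 (1 - A.eval v + B.eval v)

end Formula

/-- The truth values `0, 1/(k-1), …, (k-2)/(k-1), 1` of `k`-valued Łukasiewicz logic (`k ≥ 2`). -/
def truthValues (k : ℕ) : Set ℚ :=
  {x | ∃ j : ℕ, j < k ∧ x = (j : ℚ) / ((k : ℚ) - 1)}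

/-- Entailment in `k`-valued Łukasiewicz logic: `1` is the only designated value. -/
def Entails (k : ℕ) (Γ : Set Formula) (B : Formula) : Prop :=
  ∀ v : ℕ → ℚ, (∀ i, v i ∈ truthValues k) → (∀ A ∈ Γ, A.eval v = 1) → B.eval v = 1

/-- `A` is an instance of one of the axiom schemas in `S`. A schema is a formula whose variables
are schematic letters; its instances are its substitution instances. -/
def IsAxiomInstance (S : Finset Formula) (A : Formula) : Prop :=
  ∃ F ∈ S, ∃ σ : ℕ → Formula, A = F.subst σ

/-- `IsDerivation S Γ l`: the list `l`, written with the latest step first, is a derivation from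
`Γ` with axiom schemas `S` and modus ponens as the only rule. Each entry of `l` is one step. -/
inductive IsDerivation (S : Finset Formula) (Γ : Set Formula) : List Formula → Prop
  | nil : IsDerivation S Γ []
  | ax {l : List Formula} {A : Formula} (hl : IsDerivation S Γ l) (hA : IsAxiomInstance S A) :
      IsDerivation S Γ (A :: l)
  | hyp {l : List Formula} {A : Formula} (hl : IsDerivation S Γ l) (hA : A ∈ Γ) :
      IsDerivation S Γ (A :: l)
  | mp {l : List Formula} {A B : Formula} (hl : IsDerivation S Γ l)
      (hA : A ∈ l) (hAB : Formula.imp A B ∈ l) : IsDerivation S Γ (B :: l)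

/-- `B` has a derivation from `Γ` with exactly `n` steps. -/
def DerivableIn (S : Finset Formula) (Γ : Set Formula) (B : Formula) (n : ℕ) : Prop :=
  ∃ l : List Formula, IsDerivation S Γ (B :: l) ∧ (B :: l).length = n

/-- The finitely many axiom schemas `S`, together with modus ponens, form a Frege system for
`k`-valued Łukasiewicz logic: they are sound and implicationally complete. -/
structure IsFregeSystem (k : ℕ) (S : Finset Formula) : Prop where
  sound : ∀ (Γ : Finset Formula) (B : Formula),
    (∃ n, DerivableIn S (Γ : Set Formula) B n) → Entails k (Γ : Set Formula) B
  complete : ∀ (Γ : Finset Formula) (B : Formula),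
    Entails k (Γ : Set Formula) B → ∃ n, DerivableIn S (Γ : Set Formula) B n

/-- A sequent `ctx ⇒ concl` with a finite set of formulas on the left. -/
structure Sequent : Type where
  ctx : Finset Formula
  concl : Formula

/-- `IsOrDerivation S l`: the list `l` of sequents, written with the latest step first, is a
derivation in the Frege system with axiom schemas `S` augmented by general disjunction
elimination. In `orE`, the assumption `A` is discharged from the second premise and the
assumption `B` from the third. -/
inductive IsOrDerivation (S : Finset Formula) : List Sequent → Prop
  | nil : IsOrDerivation S []
  | ax {l : List Sequent} {A : Formula} (hl : IsOrDerivation S l) (hA : IsAxiomInstance S A) :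
      IsOrDerivation S (⟨∅, A⟩ :: l)
  | assumption {l : List Sequent} (A : Formula) (hl : IsOrDerivation S l) :
      IsOrDerivation S (⟨{A}, A⟩ :: l)
  | mp {l : List Sequent} {Γ₁ Γ₂ : Finset Formula} {A B : Formula} (hl : IsOrDerivation S l)
      (hA : ⟨Γ₁, A⟩ ∈ l) (hAB : ⟨Γ₂, Formula.imp A B⟩ ∈ l) :
      IsOrDerivation S (⟨Γ₁ ∪ Γ₂, B⟩ :: l)
  | orE {l : List Sequent} {Γ₁ Γ₂ Γ₃ : Finset Formula} {A B C : Formula}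
      (hl : IsOrDerivation S l) (hAB : ⟨Γ₁, Formula.disj A B⟩ ∈ l)
      (hA : ⟨Γ₂ ∪ {A}, C⟩ ∈ l) (hB : ⟨Γ₃ ∪ {B}, C⟩ ∈ l) :
      IsOrDerivation S (⟨Γ₁ ∪ (Γ₂ \ {A}) ∪ (Γ₃ \ {B}), C⟩ :: l)

/-- `D` has a proof with exactly `n` steps in the system with disjunction elimination, that is, a
derivation with last sequent `⇒ D`. -/
def OrProvableIn (S : Finset Formula) (D : Formula) (n : ℕ) : Prop :=
  ∃ l : List Sequent,
    IsOrDerivation S (⟨∅, D⟩ :: l) ∧ ((⟨∅, D⟩ : Sequent) :: l).length = n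

end Lukasiewicz

/-! The connective `arrow (k - 1) A B` internalises consequence: a value below 1 is at most
(k-2)/(k-1), so k-1 antecedents suffice to lift the value to 1 unless A has value 1 and B does not
(`eval_arrow_eq_one_iff`). Rules built from it can be checked by classical reasoning about which
formulas have value 1, and by completeness each fixed valid rule scheme has a derivation whose
length is the same for all instances (`IsFregeSystem.exists_extends`).

Let L list all assumptions of a given proof with n steps, so |L| ≤ n. A sequent Γ ⇒ A is translated
as `arrow (k - 1) (conjOn Γ L) A`. Since every context becomes a conjunction of the same shape, with
`top` in the unused places, contexts are compared entry by entry at cost O(|L|)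
(`exists_extends_conjOn_mono`). Each sequent step is thus simulated in O(n) steps. At the end the
conjunction for the empty context is proved and detached. The total is O(n²), which is stronger than
the required O(n² log n). -/

namespace Lukasiewicz

/-! ### Truth functions and the iterated implication. -/

namespace Formula

/-- `A ⊃ (A ⊃ ⋯ (A ⊃ B))` with `m` antecedents. -/
def arrow (m : ℕ) (A B : Formula) : Formula :=
  match m with
  | 0 => B
  | m + 1 => imp A (arrow m A B)

/-- A fixed tautology. -/
def top : Formula := imp (var 0) (var 0)

/-- The conjunction over the list `L` in which the entries outside `Γ` are replaced by `top`. -/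
def conjOn (Γ : Finset Formula) : List Formula → Formula
  | [] => top
  | A :: L => conj (if A ∈ Γ then A else top) (conjOn Γ L)

theorem subst_arrow (σ : ℕ → Formula) (m : ℕ) (A B : Formula) :
    (arrow m A B).subst σ = arrow m (A.subst σ) (B.subst σ) := by
  induction m with
  | zero => rfl
  | succ m ih => simp only [arrow, subst, ih]

theorem subst_subst (σ τ : ℕ → Formula) (A : Formula) :
    (A.subst τ).subst σ = A.subst fun i => (τ i).subst σ := by
  induction A <;> simp_all [subst]

theorem eval_mem_truthValues {k : ℕ} (hk : 2 ≤ k) {v : ℕ → ℚ} (hv : ∀ i, v i ∈ truthValues k)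
    (A : Formula) : A.eval v ∈ truthValues k := by
  have hk' : (0 : ℚ) < (k : ℚ) - 1 := by
    have : (2 : ℚ) ≤ k := by exact_mod_cast hk
    linarith
  induction A with
  | var i => exact hv i
  | neg A ih =>
    obtain ⟨j, hj, h⟩ := ih
    refine ⟨k - 1 - j, by omega, ?_⟩
    rw [Nat.cast_sub (by omega), Nat.cast_sub (by omega), eval, h]
    push_cast
    field_simp
  | conj A B ihA ihB =>
    rcases min_choice (A.eval v) (B.eval v) with h | h <;> simpa only [eval, h]
  | disj A B ihA ihB =>
    rcases max_choice (A.eval v) (B.eval v) with h | h <;> simpa only [eval, h]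
  | imp A B ihA ihB =>
    obtain ⟨a, ha, hA⟩ := ihA
    obtain ⟨b, hb, hB⟩ := ihB
    rw [eval, hA, hB]
    rcases le_or_gt a b with hab | hab
    · refine ⟨k - 1, by omega, ?_⟩
      rw [Nat.cast_sub (by omega), Nat.cast_one, div_self hk'.ne', min_eq_left]
      have : (a : ℚ) / (k - 1) ≤ b / (k - 1) := by gcongr
      linarith
    · refine ⟨k - 1 - a + b, by omega, ?_⟩
      have : (b : ℚ) / (k - 1) ≤ a / (k - 1) := by gcongr
      rw [min_eq_right (by linarith), Nat.cast_add, Nat.cast_sub (by omega),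
        Nat.cast_sub (by omega)]
      push_cast
      field_simp

theorem eval_le_one {k : ℕ} (hk : 2 ≤ k) {v : ℕ → ℚ} (hv : ∀ i, v i ∈ truthValues k)
    (A : Formula) : A.eval v ≤ 1 := by
  obtain ⟨j, hj, h⟩ := eval_mem_truthValues hk hv A
  have hk' : (2 : ℚ) ≤ k := by exact_mod_cast hk
  have hj' : (j : ℚ) + 1 ≤ k := by exact_mod_cast hj
  rw [h, div_le_one (by linarith)]
  linarith

theorem eval_nonneg {k : ℕ} (hk : 2 ≤ k) {v : ℕ → ℚ} (hv : ∀ i, v i ∈ truthValues k)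
    (A : Formula) : 0 ≤ A.eval v := by
  obtain ⟨j, hj, h⟩ := eval_mem_truthValues hk hv A
  have hk' : (2 : ℚ) ≤ k := by exact_mod_cast hk
  rw [h]
  exact div_nonneg (Nat.cast_nonneg _) (by linarith)

theorem eval_arrow {v : ℕ → ℚ} {A B : Formula} (hA : A.eval v ≤ 1) (hB : B.eval v ≤ 1) (m : ℕ) :
    (arrow m A B).eval v = min 1 (m * (1 - A.eval v) + B.eval v) := by
  induction m with
  | zero => simp [arrow, hB]
  | succ m ih =>
    rw [arrow, eval, ih]
    push_cast
    rcases le_total 1 (m * (1 - A.eval v) + B.eval v) with h | h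
    · rw [min_eq_left h, min_eq_left (by linarith), min_eq_left (by linarith)]
    · rw [min_eq_right h]
      congr 1
      ring

/-- If A has value j/(k-1) < 1, each antecedent contributes at least 1/(k-1), so k-1 of them reach
1. If A has value 1 they contribute nothing and B decides. This is the semantic deduction theorem.
-/
theorem eval_arrow_eq_one_iff {k : ℕ} (hk : 2 ≤ k) {v : ℕ → ℚ} (hv : ∀ i, v i ∈ truthValues k)
    (A B : Formula) :
    (arrow (k - 1) A B).eval v = 1 ↔ (A.eval v = 1 → B.eval v = 1) := by
  have hA := eval_le_one hk hv A
  have hB := eval_le_one hk hv B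
  have hB' := eval_nonneg hk hv B
  have hk' : (2 : ℚ) ≤ k := by exact_mod_cast hk
  rw [eval_arrow hA hB, Nat.cast_sub (by omega), Nat.cast_one]
  constructor
  · intro h hA1
    rw [hA1, sub_self, mul_zero, zero_add, min_eq_right hB] at h
    exact h
  · intro h
    by_cases hA1 : A.eval v = 1
    · simp [hA1, h hA1]
    · obtain ⟨j, hj, hjA⟩ := eval_mem_truthValues hk hv A
      -- Since A is not 1, j is at most k-2; this gap is what makes k-1 antecedents enough.
      have hjk : j + 1 ≠ k := by
        rintro rfl
        apply hA1
        rw [hjA]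
        push_cast
        rw [add_sub_cancel_right, div_self]
        push_cast at hk'
        linarith
      have hjk' : (j : ℚ) + 2 ≤ k := by exact_mod_cast (by omega : j + 2 ≤ k)
      apply min_eq_left
      have : ((k : ℚ) - 1) * (1 - A.eval v) = k - 1 - j := by
        rw [hjA]
        have : (k : ℚ) - 1 ≠ 0 := by linarith
        field_simp
      linarith

theorem eval_conj_eq_one_iff {k : ℕ} (hk : 2 ≤ k) {v : ℕ → ℚ} (hv : ∀ i, v i ∈ truthValues k)
    (A B : Formula) : (conj A B).eval v = 1 ↔ A.eval v = 1 ∧ B.eval v = 1 := by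
  have hA := eval_le_one hk hv A
  have hB := eval_le_one hk hv B
  rw [eval]
  constructor
  · intro h
    exact ⟨le_antisymm hA (h ▸ min_le_left _ _), le_antisymm hB (h ▸ min_le_right _ _)⟩
  · rintro ⟨h, h'⟩
    rw [h, h', min_self]

theorem eval_disj_eq_one_iff {k : ℕ} (hk : 2 ≤ k) {v : ℕ → ℚ} (hv : ∀ i, v i ∈ truthValues k)
    (A B : Formula) : (disj A B).eval v = 1 ↔ A.eval v = 1 ∨ B.eval v = 1 := by
  have hA := eval_le_one hk hv A
  have hB := eval_le_one hk hv B
  rw [eval]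
  constructor
  · intro h
    rcases max_choice (A.eval v) (B.eval v) with h' | h'
    · exact Or.inl (h' ▸ h)
    · exact Or.inr (h' ▸ h)
  · rintro (h | h)
    · rw [h, max_eq_left hB]
    · rw [h, max_eq_right hA]

theorem eval_imp_eq_one {k : ℕ} (hk : 2 ≤ k) {v : ℕ → ℚ} (hv : ∀ i, v i ∈ truthValues k)
    {A B : Formula} (hA : A.eval v = 1) (hAB : (imp A B).eval v = 1) : B.eval v = 1 := by
  rwa [eval, hA, sub_self, zero_add, min_eq_right (eval_le_one hk hv B)] at hAB

theorem eval_top (v : ℕ → ℚ) : top.eval v = 1 := by simp [top, eval]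

end Formula

open Formula

/-! ### Bounded extensions of derivations. -/

/-- The derivation `d` extends, by at most `c` further steps, to one that contains `B`. -/
def Extends (S : Finset Formula) (d : List Formula) (c : ℕ) (B : Formula) : Prop :=
  ∃ d', IsDerivation S ∅ d' ∧ d ⊆ d' ∧ B ∈ d' ∧ d'.length ≤ d.length + c

/-- The substituted steps are replayed on top of `d`: instances of axioms remain instances, modus
ponens is preserved, and hypotheses cost nothing because they already occur in `d`. -/
theorem IsDerivation.exists_subst {S : Finset Formula} {Γ : Set Formula} {l d : List Formula}
    (hl : IsDerivation S Γ l) (σ : ℕ → Formula) (hd : IsDerivation S ∅ d)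
    (hΓ : ∀ A ∈ Γ, A.subst σ ∈ d) :
    ∃ d', IsDerivation S ∅ d' ∧ d ⊆ d' ∧ (∀ A ∈ l, A.subst σ ∈ d') ∧
      d'.length ≤ d.length + l.length := by
  induction hl with
  | nil => exact ⟨d, hd, List.Subset.refl d, by simp, by simp⟩
  | ax _ hA ih =>
    obtain ⟨d', h₁, h₂, h₃, h₄⟩ := ih
    obtain ⟨F, hF, τ, rfl⟩ := hA
    refine ⟨(F.subst τ).subst σ :: d', .ax h₁ ⟨F, hF, _, subst_subst σ τ F⟩,
      List.subset_cons_of_subset _ h₂, ?_, ?_⟩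
    · simpa using fun A hA => Or.inr (h₃ A hA)
    · simp only [List.length_cons]; omega
  | hyp _ hA ih =>
    obtain ⟨d', h₁, h₂, h₃, h₄⟩ := ih
    refine ⟨d', h₁, h₂, ?_, ?_⟩
    · simpa using ⟨h₂ (hΓ _ hA), h₃⟩
    · simp only [List.length_cons]; omega
  | @mp l A B _ hA hAB ih =>
    obtain ⟨d', h₁, h₂, h₃, h₄⟩ := ih
    refine ⟨B.subst σ :: d', .mp h₁ (h₃ _ hA) (h₃ _ hAB),
      List.subset_cons_of_subset _ h₂, ?_, ?_⟩
    · simpa using fun A hA => Or.inr (h₃ A hA)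
    · simp only [List.length_cons]; omega

/-- With the latest step first, every suffix of a derivation is a derivation, so the list can be cut
at an occurrence of B. -/
theorem IsDerivation.derivableIn {S : Finset Formula} {Γ : Set Formula} {l : List Formula}
    {B : Formula} (hl : IsDerivation S Γ l) (hB : B ∈ l) :
    ∃ m ≤ l.length, DerivableIn S Γ B m := by
  have key : ∀ (A : Formula) (l : List Formula), IsDerivation S Γ (A :: l) →
      (B ∈ l → ∃ m ≤ l.length, DerivableIn S Γ B m) → B ∈ A :: l →
      ∃ m ≤ (A :: l).length, DerivableIn S Γ B m := by
    intro A l h ih hB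
    rcases List.mem_cons.1 hB with rfl | hB
    · exact ⟨_, le_rfl, l, h, rfl⟩
    · obtain ⟨m, hm, h⟩ := ih hB
      exact ⟨m, hm.trans (by simp), h⟩
  induction hl with
  | nil => simp at hB
  | ax hl hA ih => exact key _ _ (.ax hl hA) ih hB
  | hyp hl hA ih => exact key _ _ (.hyp hl hA) ih hB
  | mp hl hA hAB ih => exact key _ _ (.mp hl hA hAB) ih hB

section Frege

variable {k : ℕ} {S : Finset Formula}

/-- Every valid schematic rule can be applied in a bounded number of steps. -/
theorem IsFregeSystem.exists_extends (hS : IsFregeSystem k S) (Γ : List Formula) (B : Formula)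
    (h : ∀ v : ℕ → ℚ, (∀ i, v i ∈ truthValues k) → (∀ A ∈ Γ, A.eval v = 1) → B.eval v = 1) :
    ∃ c, ∀ (σ : ℕ → Formula) (d : List Formula), IsDerivation S ∅ d →
      (∀ A ∈ Γ, A.subst σ ∈ d) → Extends S d c (B.subst σ) := by
  obtain ⟨n, l, hl, -⟩ := hS.complete Γ.toFinset B fun v hv hΓ => h v hv (by simpa using hΓ)
  refine ⟨(B :: l).length, fun σ d hd hΓ => ?_⟩
  obtain ⟨d', h₁, h₂, h₃, h₄⟩ := hl.exists_subst σ hd (by simpa using hΓ)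
  exact ⟨d', h₁, h₂, h₃ B (by simp), h₄⟩

/-- The substitution `pᵢ₊₁ ↦ l[i]` that fixes all other variables. -/
def substList (l : List Formula) : ℕ → Formula
  -- Variable 0 stays fixed because `top` is built from it; `top` then survives substitution
  -- unchanged, and schematic letters start at 1.
  | 0 => var 0
  | i + 1 => l.getD i (var (i + 1))

/-! ### Comparing contexts along a common list. -/

/-- Weakening by induction on L, one bounded rule application per entry. The extra conjunct E stands
for a discharged assumption, which may lie in Γ but not in Δ; `top` serves when nothing is
discharged. -/
theorem exists_extends_conjOn_mono (hk : 2 ≤ k) (hS : IsFregeSystem k S) :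
    ∃ c, ∀ (E : Formula) (Γ Δ : Finset Formula), Γ ⊆ insert E Δ →
      ∀ (L d : List Formula), IsDerivation S ∅ d →
        Extends S d (c * (L.length + 1))
          (arrow (k - 1) (conj E (conjOn Δ L)) (conjOn Γ L)) := by
  obtain ⟨c₀, h₀⟩ := hS.exists_extends [] (arrow (k - 1) (conj (var 1) top) top) (by
    intro v hv _
    simp only [eval_arrow_eq_one_iff hk hv, eval_top, implies_true])
  -- Y is the next entry of the target conjunction: E itself, the corresponding entry for Δ, or
  -- `top` when the entry is not in Γ.
  have step (Y : Formula) (hY : Y = var 1 ∨ Y = var 2 ∨ Y = top) :=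
    hS.exists_extends [arrow (k - 1) (conj (var 1) (var 3)) (var 4)]
      (arrow (k - 1) (conj (var 1) (conj (var 2) (var 3))) (conj Y (var 4))) (by
      intro v hv
      simp only [List.mem_singleton, forall_eq, eval_arrow_eq_one_iff hk hv,
        eval_conj_eq_one_iff hk hv]
      have := eval_top v
      rcases hY with rfl | rfl | rfl <;> tauto)
  obtain ⟨c₁, h₁⟩ := step (var 1) (by simp)
  obtain ⟨c₂, h₂⟩ := step (var 2) (by simp)
  obtain ⟨c₃, h₃⟩ := step top (by simp)
  refine ⟨c₀ + c₁ + c₂ + c₃, fun E Γ Δ hΓ L => ?_⟩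
  induction L with
  | nil =>
    intro d hd
    obtain ⟨d', h, h', h'', h'''⟩ := h₀ (substList [E]) d hd (by simp)
    rw [subst_arrow] at h''
    exact ⟨d', h, h', h'', h'''.trans (by simp; omega)⟩
  | cons A L ih =>
    intro d hd
    obtain ⟨d₁, hd₁, hsub₁, hmem₁, hlen₁⟩ := ih d hd
    let X := if A ∈ Δ then A else top
    let σ := substList [E, X, conjOn Δ L, conjOn Γ L]
    have hprem : ∀ F ∈ [arrow (k - 1) (conj (var 1) (var 3)) (var 4)], F.subst σ ∈ d₁ := by
      simp only [List.mem_singleton, forall_eq, subst_arrow]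
      exact hmem₁
    have main : Extends S d₁ (c₀ + c₁ + c₂ + c₃)
        (arrow (k - 1) (conj E (conj X (conjOn Δ L)))
          (conj (if A ∈ Γ then A else top) (conjOn Γ L))) := by
      by_cases hA : A ∈ Γ
      · rw [if_pos hA]
        rcases Finset.mem_insert.1 (hΓ hA) with rfl | hAΔ
        · obtain ⟨d', h, h', h'', h'''⟩ := h₁ σ d₁ hd₁ hprem
          rw [subst_arrow] at h''
          exact ⟨d', h, h', h'', h'''.trans (by omega)⟩
        · obtain ⟨d', h, h', h'', h'''⟩ := h₂ σ d₁ hd₁ hprem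
          rw [subst_arrow] at h''
          have hX : X = A := if_pos hAΔ
          have h5 : arrow (k - 1) (conj E (conj X (conjOn Δ L))) (conj X (conjOn Γ L)) ∈ d' := h''
          rw [hX] at h5 ⊢
          exact ⟨d', h, h', h5, h'''.trans (by omega)⟩
      · rw [if_neg hA]
        obtain ⟨d', h, h', h'', h'''⟩ := h₃ σ d₁ hd₁ hprem
        rw [subst_arrow] at h''
        exact ⟨d', h, h', h'', h'''.trans (by omega)⟩
    obtain ⟨d₂, hd₂, hsub₂, hmem₂, hlen₂⟩ := main
    refine ⟨d₂, hd₂, List.Subset.trans hsub₁ hsub₂, hmem₂, ?_⟩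
    rw [List.length_cons, mul_add _ (L.length + 1), mul_one]
    omega

theorem exists_extends_conjOn_empty (hk : 2 ≤ k) (hS : IsFregeSystem k S) :
    ∃ c, ∀ (L d : List Formula), IsDerivation S ∅ d →
        Extends S d (c * (L.length + 1)) (conjOn ∅ L) := by
  obtain ⟨c₀, h₀⟩ := hS.exists_extends [] top fun v _ _ => eval_top v
  obtain ⟨c₁, h₁⟩ := hS.exists_extends [var 1] (conj top (var 1)) (by
    intro v hv
    simp only [List.mem_singleton, forall_eq, eval_conj_eq_one_iff hk hv, eval_top]
    tauto)
  refine ⟨c₀ + c₁, fun L => ?_⟩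
  induction L with
  | nil =>
    intro d hd
    obtain ⟨d', h, h', h'', h'''⟩ := h₀ (substList []) d hd (by simp)
    exact ⟨d', h, h', h'', h'''.trans (by simp)⟩
  | cons A L ih =>
    intro d hd
    obtain ⟨d₁, hd₁, hsub₁, hmem₁, hlen₁⟩ := ih d hd
    obtain ⟨d₂, hd₂, hsub₂, hmem₂, hlen₂⟩ := h₁ (substList [conjOn ∅ L]) d₁ hd₁ (by
      simp only [List.mem_singleton, forall_eq]
      exact hmem₁)
    refine ⟨d₂, hd₂, List.Subset.trans hsub₁ hsub₂, hmem₂, ?_⟩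
    rw [List.length_cons, mul_add _ (L.length + 1), mul_one]
    omega

/-! ### Simulating single steps. -/

theorem exists_extends_ax (hk : 2 ≤ k) (hS : IsFregeSystem k S) :
    ∃ c, ∀ (d : List Formula), IsDerivation S ∅ d → ∀ G A : Formula, IsAxiomInstance S A →
      Extends S d c (arrow (k - 1) G A) := by
  obtain ⟨c, h⟩ := hS.exists_extends [var 2] (arrow (k - 1) (var 1) (var 2)) (by
    intro v hv
    simp only [List.mem_singleton, forall_eq, eval_arrow_eq_one_iff hk hv]
    tauto)
  refine ⟨c + 1, fun d hd G A hA => ?_⟩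
  obtain ⟨d', h₁, h₂, h₃, h₄⟩ := h (substList [G, A]) (A :: d) (.ax hd hA) (by
    simp only [List.mem_singleton, forall_eq]
    exact List.mem_cons_self)
  rw [subst_arrow] at h₃
  refine ⟨d', h₁, List.Subset.trans (List.subset_cons_self _ _) h₂, h₃, ?_⟩
  rw [List.length_cons] at h₄
  omega

theorem exists_extends_assumption (hk : 2 ≤ k) (hS : IsFregeSystem k S) :
    ∃ c, ∀ (A : Formula) (L d : List Formula), A ∈ L → IsDerivation S ∅ d →
      Extends S d (c * (L.length + 1)) (arrow (k - 1) (conjOn {A} L) A) := by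
  obtain ⟨c₀, h₀⟩ := hS.exists_extends [] (arrow (k - 1) (conj (var 1) (var 2)) (var 1)) (by
    intro v hv
    simp only [eval_arrow_eq_one_iff hk hv, eval_conj_eq_one_iff hk hv]
    tauto)
  obtain ⟨c₁, h₁⟩ := hS.exists_extends [arrow (k - 1) (var 2) (var 3)]
    (arrow (k - 1) (conj (var 1) (var 2)) (var 3)) (by
    intro v hv
    simp only [List.mem_singleton, forall_eq, eval_arrow_eq_one_iff hk hv,
      eval_conj_eq_one_iff hk hv]
    tauto)
  refine ⟨c₀ + c₁, fun A L => ?_⟩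
  induction L with
  | nil => simp
  | cons B L ih =>
    intro d hB hd
    rw [List.length_cons, mul_add _ (L.length + 1), mul_one]
    by_cases hAB : A = B
    · subst hAB
      obtain ⟨d', h, h', h'', h'''⟩ := h₀ (substList [A, conjOn {A} L]) d hd (by simp)
      rw [subst_arrow] at h''
      refine ⟨d', h, h', ?_, h'''.trans (by omega)⟩
      rw [conjOn, if_pos (Finset.mem_singleton_self A)]
      exact h''
    · obtain ⟨d₁, hd₁, hsub₁, hmem₁, hlen₁⟩ := ih d (List.mem_of_ne_of_mem hAB hB) hd
      obtain ⟨d₂, hd₂, hsub₂, hmem₂, hlen₂⟩ :=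
        h₁ (substList [if B ∈ ({A} : Finset Formula) then B else top, conjOn {A} L, A]) d₁ hd₁ (by
          simp only [List.mem_singleton, forall_eq, subst_arrow]
          exact hmem₁)
      rw [subst_arrow] at hmem₂
      exact ⟨d₂, hd₂, List.Subset.trans hsub₁ hsub₂, hmem₂, by omega⟩

theorem exists_extends_mp (hk : 2 ≤ k) (hS : IsFregeSystem k S) :
    ∃ c, ∀ (Γ₁ Γ₂ : Finset Formula) (A B : Formula) (L d : List Formula), IsDerivation S ∅ d →
      arrow (k - 1) (conjOn Γ₁ L) A ∈ d → arrow (k - 1) (conjOn Γ₂ L) (imp A B) ∈ d →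
      Extends S d (c * (L.length + 1)) (arrow (k - 1) (conjOn (Γ₁ ∪ Γ₂) L) B) := by
  obtain ⟨c₀, h₀⟩ := exists_extends_conjOn_mono hk hS
  obtain ⟨c₁, h₁⟩ := hS.exists_extends
    [arrow (k - 1) (conj top (var 1)) (var 2), arrow (k - 1) (conj top (var 1)) (var 3),
      arrow (k - 1) (var 2) (var 4), arrow (k - 1) (var 3) (imp (var 4) (var 5))]
    (arrow (k - 1) (var 1) (var 5)) (by
    intro v hv
    simp only [List.forall_mem_cons, List.not_mem_nil, false_imp_iff, implies_true, and_true,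
      eval_arrow_eq_one_iff hk hv, eval_conj_eq_one_iff hk hv, eval_top, true_and]
    rintro ⟨h, h', h'', h'''⟩ h₁
    exact eval_imp_eq_one hk hv (h'' (h h₁)) (h''' (h' h₁)))
  refine ⟨c₀ + c₀ + c₁, fun Γ₁ Γ₂ A B L d hd hA hAB => ?_⟩
  -- Modus ponens discharges nothing, so both contexts are weakened to their union with `top` as the
  -- extra conjunct.
  obtain ⟨d₁, hd₁, hsub₁, hmem₁, hlen₁⟩ := h₀ top Γ₁ (Γ₁ ∪ Γ₂) (by grind) L d hd
  obtain ⟨d₂, hd₂, hsub₂, hmem₂, hlen₂⟩ := h₀ top Γ₂ (Γ₁ ∪ Γ₂) (by grind) L d₁ hd₁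
  obtain ⟨d₃, hd₃, hsub₃, hmem₃, hlen₃⟩ :=
    h₁ (substList [conjOn (Γ₁ ∪ Γ₂) L, conjOn Γ₁ L, conjOn Γ₂ L, A, B]) d₂ hd₂ (by
      simp only [List.forall_mem_cons, List.not_mem_nil, false_imp_iff, implies_true, and_true,
        subst_arrow]
      exact ⟨hsub₂ hmem₁, hmem₂, hsub₂ (hsub₁ hA), hsub₂ (hsub₁ hAB)⟩)
  rw [subst_arrow] at hmem₃
  refine ⟨d₃, hd₃, List.Subset.trans (List.Subset.trans hsub₁ hsub₂) hsub₃, hmem₃, ?_⟩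
  have : c₁ ≤ c₁ * (L.length + 1) := Nat.le_mul_of_pos_right c₁ (Nat.succ_pos L.length)
  rw [add_mul, add_mul]
  omega

/-- Reasoning by cases is valid for the translations because a disjunction has value 1 only if a
disjunct does. Three weakenings to the final context reduce the rule to one fixed scheme. -/
theorem exists_extends_orE (hk : 2 ≤ k) (hS : IsFregeSystem k S) :
    ∃ c, ∀ (Γ₁ Γ₂ Γ₃ : Finset Formula) (A B C : Formula) (L d : List Formula),
      IsDerivation S ∅ d → arrow (k - 1) (conjOn Γ₁ L) (disj A B) ∈ d →
      arrow (k - 1) (conjOn (Γ₂ ∪ {A}) L) C ∈ d → arrow (k - 1) (conjOn (Γ₃ ∪ {B}) L) C ∈ d →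
      Extends S d (c * (L.length + 1))
        (arrow (k - 1) (conjOn (Γ₁ ∪ (Γ₂ \ {A}) ∪ (Γ₃ \ {B})) L) C) := by
  obtain ⟨c₀, h₀⟩ := exists_extends_conjOn_mono hk hS
  obtain ⟨c₁, h₁⟩ := hS.exists_extends
    [arrow (k - 1) (conj top (var 1)) (var 2), arrow (k - 1) (conj (var 5) (var 1)) (var 3),
      arrow (k - 1) (conj (var 6) (var 1)) (var 4), arrow (k - 1) (var 2) (disj (var 5) (var 6)),
      arrow (k - 1) (var 3) (var 7), arrow (k - 1) (var 4) (var 7)]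
    (arrow (k - 1) (var 1) (var 7)) (by
    intro v hv
    simp only [List.forall_mem_cons, List.not_mem_nil, false_imp_iff, implies_true, and_true,
      eval_arrow_eq_one_iff hk hv, eval_conj_eq_one_iff hk hv, eval_disj_eq_one_iff hk hv,
      eval_top, true_and]
    tauto)
  refine ⟨c₀ + c₀ + c₀ + c₁, fun Γ₁ Γ₂ Γ₃ A B C L d hd hAB hA hB => ?_⟩
  set Δ := Γ₁ ∪ (Γ₂ \ {A}) ∪ (Γ₃ \ {B}) with hΔ
  obtain ⟨d₁, hd₁, hsub₁, hmem₁, hlen₁⟩ := h₀ top Γ₁ Δ (by grind) L d hd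
  -- The discharged disjunct A takes the role of the extra conjunct, since it may be missing from Δ;
  -- B does the same in the third premise.
  obtain ⟨d₂, hd₂, hsub₂, hmem₂, hlen₂⟩ := h₀ A (Γ₂ ∪ {A}) Δ (by grind) L d₁ hd₁
  obtain ⟨d₃, hd₃, hsub₃, hmem₃, hlen₃⟩ := h₀ B (Γ₃ ∪ {B}) Δ (by grind) L d₂ hd₂
  have hsub : d ⊆ d₃ := List.Subset.trans (List.Subset.trans hsub₁ hsub₂) hsub₃
  obtain ⟨d₄, hd₄, hsub₄, hmem₄, hlen₄⟩ :=
    h₁ (substList [conjOn Δ L, conjOn Γ₁ L, conjOn (Γ₂ ∪ {A}) L, conjOn (Γ₃ ∪ {B}) L, A, B, C])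
      d₃ hd₃ (by
      simp only [List.forall_mem_cons, List.not_mem_nil, false_imp_iff, implies_true, and_true,
        subst_arrow]
      exact ⟨hsub₃ (hsub₂ hmem₁), hsub₃ hmem₂, hmem₃, hsub hAB, hsub hA, hsub hB⟩)
  rw [subst_arrow] at hmem₄
  refine ⟨d₄, hd₄, List.Subset.trans hsub hsub₄, hmem₄, ?_⟩
  have : c₁ ≤ c₁ * (L.length + 1) := Nat.le_mul_of_pos_right c₁ (Nat.succ_pos L.length)
  rw [add_mul, add_mul, add_mul]
  omega

/-! ### Simulating whole derivations. -/

/-- Each step of the system with disjunction elimination costs linearly many steps in the length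
of a list that contains all open assumptions. -/
theorem IsOrDerivation.exists_simulation (hk : 2 ≤ k) (hS : IsFregeSystem k S) :
    ∃ c, ∀ (L : List Formula) (l : List Sequent), IsOrDerivation S l →
      (∀ s ∈ l, s.ctx ⊆ L.toFinset) →
      ∃ d, IsDerivation S ∅ d ∧ (∀ s ∈ l, arrow (k - 1) (conjOn s.ctx L) s.concl ∈ d) ∧
        d.length ≤ l.length * (c * (L.length + 1)) := by
  obtain ⟨c₁, h₁⟩ := exists_extends_ax hk hS
  obtain ⟨c₂, h₂⟩ := exists_extends_assumption hk hS
  obtain ⟨c₃, h₃⟩ := exists_extends_mp hk hS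
  obtain ⟨c₄, h₄⟩ := exists_extends_orE hk hS
  refine ⟨c₁ + c₂ + c₃ + c₄, fun L l hl => ?_⟩
  -- Bookkeeping common to all rules: one more sequent, paid for within the per-step budget.
  have key : ∀ (s : Sequent) (l : List Sequent) (d : List Formula) (c : ℕ),
      (∀ t ∈ l, arrow (k - 1) (conjOn t.ctx L) t.concl ∈ d) →
      d.length ≤ l.length * ((c₁ + c₂ + c₃ + c₄) * (L.length + 1)) →
      Extends S d c (arrow (k - 1) (conjOn s.ctx L) s.concl) →
      c ≤ (c₁ + c₂ + c₃ + c₄) * (L.length + 1) →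
      ∃ d, IsDerivation S ∅ d ∧ (∀ t ∈ s :: l, arrow (k - 1) (conjOn t.ctx L) t.concl ∈ d) ∧
        d.length ≤ (s :: l).length * ((c₁ + c₂ + c₃ + c₄) * (L.length + 1)) := by
    rintro s l d c hl hd ⟨d', h, h', h'', h'''⟩ hc
    refine ⟨d', h, List.forall_mem_cons.2 ⟨h'', fun t ht => h' (hl t ht)⟩, ?_⟩
    rw [List.length_cons, add_mul, one_mul]
    omega
  induction hl with
  | nil => exact fun _ => ⟨[], .nil, by simp, by simp⟩
  | ax _ hA ih =>
    intro hctx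
    obtain ⟨d, hd, hmem, hlen⟩ := ih (List.forall_mem_cons.1 hctx).2
    refine key _ _ d _ hmem hlen (h₁ d hd _ _ hA) ?_
    nlinarith [Nat.zero_le (c₁ * L.length), Nat.zero_le ((c₂ + c₃ + c₄) * (L.length + 1))]
  | assumption A _ ih =>
    intro hctx
    obtain ⟨hs, hctx⟩ := List.forall_mem_cons.1 hctx
    obtain ⟨d, hd, hmem, hlen⟩ := ih hctx
    refine key _ _ d _ hmem hlen (h₂ A L d (by simpa using hs) hd) ?_
    gcongr
    omega
  | mp _ hA hAB ih =>
    intro hctx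
    obtain ⟨d, hd, hmem, hlen⟩ := ih (List.forall_mem_cons.1 hctx).2
    refine key _ _ d _ hmem hlen (h₃ _ _ _ _ L d hd (hmem _ hA) (hmem _ hAB)) ?_
    gcongr
    omega
  | orE _ hAB hA hB ih =>
    intro hctx
    obtain ⟨d, hd, hmem, hlen⟩ := ih (List.forall_mem_cons.1 hctx).2
    refine key _ _ d _ hmem hlen
      (h₄ _ _ _ _ _ _ L d hd (hmem _ hAB) (hmem _ hA) (hmem _ hB)) ?_
    gcongr
    omega

/-- The assumptions used in a derivation are at most as many as its steps. -/
theorem IsOrDerivation.exists_assumptions {l : List Sequent} (hl : IsOrDerivation S l) :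
    ∃ L : List Formula, L.length ≤ l.length ∧ ∀ s ∈ l, s.ctx ⊆ L.toFinset := by
  induction hl with
  | nil => exact ⟨[], by simp, by simp⟩
  | ax _ _ ih =>
    obtain ⟨L, hL, h⟩ := ih
    exact ⟨L, hL.trans (by simp), List.forall_mem_cons.2 ⟨Finset.empty_subset _, h⟩⟩
  | assumption A _ ih =>
    obtain ⟨L, hL, h⟩ := ih
    refine ⟨A :: L, by simpa using hL, List.forall_mem_cons.2 ⟨by simp, fun s hs => ?_⟩⟩
    exact (h s hs).trans (by simp)
  | mp _ hA hAB ih =>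
    obtain ⟨L, hL, h⟩ := ih
    exact ⟨L, hL.trans (by simp),
      List.forall_mem_cons.2 ⟨Finset.union_subset (h _ hA) (h _ hAB), h⟩⟩
  -- Contexts gain new formulas only at assumption axioms, so the same L still works here.
  | orE _ hAB hA hB ih =>
    obtain ⟨L, hL, h⟩ := ih
    refine ⟨L, hL.trans (by simp), List.forall_mem_cons.2 ⟨?_, h⟩⟩
    have h₂ := Finset.union_subset_iff.1 (h _ hA)
    have h₃ := Finset.union_subset_iff.1 (h _ hB)
    exact Finset.union_subset
      (Finset.union_subset (h _ hAB) (Finset.sdiff_subset.trans h₂.1))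
      (Finset.sdiff_subset.trans h₃.1)

/-- Disjunction elimination can be removed at quadratic cost. -/
theorem IsFregeSystem.exists_quadratic_bound (hk : 2 ≤ k) (hS : IsFregeSystem k S) :
    ∃ c, ∀ (D : Formula) (n : ℕ), OrProvableIn S D n →
      ∃ m ≤ c * (n + 1) ^ 2, DerivableIn S ∅ D m := by
  obtain ⟨c₀, h₀⟩ := IsOrDerivation.exists_simulation hk hS
  obtain ⟨c₁, h₁⟩ := exists_extends_conjOn_empty hk hS
  -- This scheme detaches the final D from the conjunction for the empty context, whose entries are
  -- all `top`.
  obtain ⟨c₂, h₂⟩ := hS.exists_extends [var 1, arrow (k - 1) (var 1) (var 2)] (var 2) (by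
    intro v hv
    simp only [List.forall_mem_cons, List.not_mem_nil, false_imp_iff, implies_true, and_true,
      eval_arrow_eq_one_iff hk hv]
    tauto)
  refine ⟨c₀ + c₁ + c₂, ?_⟩
  rintro D n ⟨l, hl, hn⟩
  obtain ⟨L, hL, hctx⟩ := hl.exists_assumptions
  obtain ⟨d₀, hd₀, hmem₀, hlen₀⟩ := h₀ L _ hl hctx
  obtain ⟨d₁, hd₁, hsub₁, hmem₁, hlen₁⟩ := h₁ L d₀ hd₀
  obtain ⟨d₂, hd₂, hsub₂, hmem₂, hlen₂⟩ := h₂ (substList [conjOn ∅ L, D]) d₁ hd₁ (by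
    simp only [List.forall_mem_cons, List.not_mem_nil, false_imp_iff, implies_true, and_true,
      subst_arrow]
    exact ⟨hmem₁, hsub₁ (hmem₀ _ List.mem_cons_self)⟩)
  obtain ⟨m, hm, h⟩ := hd₂.derivableIn hmem₂
  refine ⟨m, ?_, h⟩
  rw [hn] at hL hlen₀
  have e₀ : n * (c₀ * (L.length + 1)) ≤ c₀ * (n + 1) ^ 2 := by
    calc n * (c₀ * (L.length + 1)) ≤ (n + 1) * (c₀ * (n + 1)) := by gcongr; omega
      _ = c₀ * (n + 1) ^ 2 := by ring
  have e₁ : c₁ * (L.length + 1) ≤ c₁ * (n + 1) ^ 2 := by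
    gcongr
    nlinarith
  have e₂ : c₂ ≤ c₂ * (n + 1) ^ 2 := Nat.le_mul_of_pos_right _ (by positivity)
  rw [add_mul, add_mul]
  change d₂.length ≤ _ at hlen₂
  omega

end Frege

/-! ### Asymptotics. -/

theorem isBigO_succ_sq (c : ℕ) :
    (fun n : ℕ => ((c * (n + 1) ^ 2 : ℕ) : ℝ)) =O[Filter.atTop]
      (fun n : ℕ => (n : ℝ) ^ 2 * Real.log (n : ℝ)) := by
  refine Asymptotics.IsBigO.of_bound (4 * c) ?_
  filter_upwards [Filter.eventually_ge_atTop 3] with n hn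
  have hn' : (3 : ℝ) ≤ n := by exact_mod_cast hn
  -- Here n ≥ 3 > e, so the logarithmic factor is at least 1 and can be inserted for free.
  have hlog : 1 ≤ Real.log n := by
    rw [Real.le_log_iff_exp_le (by linarith)]
    linarith [Real.exp_one_lt_d9]
  rw [Real.norm_of_nonneg (by positivity), Real.norm_of_nonneg (by positivity)]
  push_cast
  calc (c : ℝ) * (n + 1) ^ 2 ≤ c * (4 * (n ^ 2 * 1)) := by gcongr; nlinarith
    _ ≤ c * (4 * (n ^ 2 * Real.log n)) := by gcongr
    _ = 4 * c * (n ^ 2 * Real.log n) := by ring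

end Lukasiewicz

theorem mainTheorem6 (k : ℕ) (hk : 2 ≤ k) (S : Finset Lukasiewicz.Formula)
    (hS : Lukasiewicz.IsFregeSystem k S) :
    ∃ f : ℕ → ℕ,
      ((fun n : ℕ => (f n : ℝ)) =O[Filter.atTop] (fun n : ℕ => (n : ℝ) ^ 2 * Real.log (n : ℝ))) ∧
      ∀ (D : Lukasiewicz.Formula) (n : ℕ), Lukasiewicz.OrProvableIn S D n →
        ∃ m ≤ f n, Lukasiewicz.DerivableIn S ∅ D m := by
  obtain ⟨c, h⟩ := hS.exists_quadratic_bound hk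
  exact ⟨fun n => c * (n + 1) ^ 2, Lukasiewicz.isBigO_succ_sq c, h⟩
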